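/- Throughout, an $n$-ary Boolean relation ($n\ge 1$) is a subset $R\subseteq\{0,1\}^n$. A clause is a finite disjunction of literals (variables or negated variables), and a CNF-formula is a conjunction of finitely many, and at least one, clauses. $R$ is \emph{Horn} if it is the set of solutions of a CNF-formula over $n$ variables each of whose clauses contains at most one positive literal. $R$ is \emph{IHSB$-$} if it is the set of solutions of such a formula in which, moreover, every clause with more than two literals has only negative literals. Let $G(R)$ be the subgraph of the $n$-dimensional hypercube graph induced by $R$. $R$ is \emph{componentwise IHSB$-$} if every connected component of $G(R)$, viewed as an $n$-ary relation, is IHSB$-$; $R$ is \emph{safely componentwise IHSB$-$} if $R$ and every relation obtained from $R$ by identification of variables is componentwise IHSB$-$. A $\mathrm{CNF}_C(\{R\})$-formula over a set $V$ of variables is a finite conjunction of constraints of the form $R(\xi_1,\dots,\xi_n)$, where each $\xi_j$ is a variable from $V$ or one of the constants $0,1$. \textbf{Lemma.} Let $R$ be a Horn relation that is not safely componentwise IHSB$-$. Then the ternary relation $$M(x,y,z)=(x\vee\overline{y}\vee\overline{z})\wedge(\overline{x}\vee z)$$ is expressible as a $\mathrm{CNF}_C(\{R\})$-formula, i.e.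 there is a $\mathrm{CNF}_C(\{R\})$-formula over the variables $x,y,z$ whose set of solutions is exactly $M$. -/

import Mathlib

/-! Boolean (logical) relations: an `n`-ary relation is a `Set (Fin n → Bool)`, with `n ≥ 1`. -/

namespace BoolCSP

/-- A literal over the variables `V`: `(x, true)` is the variable `x`, `(x, false)` its negation. -/
abbrev Literal (V : Type) : Type := V × Bool

/-- A clause: a finite disjunction of literals. -/
abbrev Clause (V : Type) : Type := Finset (Literal V)

/-- The assignment `a` satisfies some literal of the clause `c`. -/
def Clause.Sat {V : Type} (c : Clause V) (a : V → Bool) : Prop :=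
  ∃ l ∈ c, a l.1 = l.2

/-- The clause has at most one positive literal. -/
def Clause.IsHorn {V : Type} (c : Clause V) : Prop :=
  (c.filter (fun l => l.2 = true)).card ≤ 1

/-- If the clause has more than two literals, then all of them are negative. -/
def Clause.IsIHSBMinus {V : Type} (c : Clause V) : Prop :=
  2 < c.card → ∀ l ∈ c, l.2 = false

/-- A CNF-formula: a conjunction of `m ≥ 1` clauses. -/
structure CNF (V : Type) where
  clauses : List (Clause V)
  ne_nil : clauses ≠ []

/-- The set of solutions of a CNF-formula. -/
def CNF.solutions {V : Type} (φ : CNF V) : Set (V → Bool) :=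
  {a | ∀ c ∈ φ.clauses, c.Sat a}

/-- `R` is Horn: it is the set of solutions of a Horn formula. -/
def IsHorn {n : ℕ} (R : Set (Fin n → Bool)) : Prop :=
  ∃ φ : CNF (Fin n), (∀ c ∈ φ.clauses, c.IsHorn) ∧ φ.solutions = R

/-- `R` is IHSB−: it is the set of solutions of a Horn formula in which all clauses with more
than two literals have only negative literals. -/
def IsIHSBMinus {n : ℕ} (R : Set (Fin n → Bool)) : Prop :=
  ∃ φ : CNF (Fin n), (∀ c ∈ φ.clauses, c.IsHorn ∧ c.IsIHSBMinus) ∧ φ.solutions = R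

/-- The `n`-dimensional hypercube graph: vectors at Hamming distance 1 are adjacent. -/
def hypercube (n : ℕ) : SimpleGraph (Fin n → Bool) where
  Adj a b := hammingDist a b = 1
  symm := ⟨fun a b h => by rw [hammingDist_comm]; exact h⟩
  loopless := ⟨fun a h => by simp [hammingDist_self] at h⟩

/-- The solution graph `G(R)`: the subgraph of the hypercube induced by `R`. -/
def solutionGraph {n : ℕ} (R : Set (Fin n → Bool)) : SimpleGraph R :=
  (hypercube n).induce R

/-- Every connected component of `G(R)`, as an `n`-ary relation, is IHSB−. -/
def IsComponentwiseIHSBMinus {n : ℕ} (R : Set (Fin n → Bool)) : Prop :=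
  ∀ C : (solutionGraph R).ConnectedComponent, IsIHSBMinus (Subtype.val '' C.supp)

/-- The relation obtained from `R` by replacing the variable at each position `i` by the variable
`f i`. For surjective `f` this is an identification of variables. -/
def identify {n m : ℕ} (R : Set (Fin n → Bool)) (f : Fin n → Fin m) : Set (Fin m → Bool) :=
  {b | (fun i => b (f i)) ∈ R}

/-- `R` and every relation obtained from `R` by identification of variables is componentwise
IHSB− (`R` itself is the case where `f` is the identity). -/
def IsSafelyComponentwiseIHSBMinus {n : ℕ} (R : Set (Fin n → Bool)) : Prop :=
  ∀ (m : ℕ) (f : Fin n → Fin m), Function.Surjective f →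
    IsComponentwiseIHSBMinus (identify R f)

/-- An argument of a constraint: a variable from `V` or one of the constants 0 and 1. -/
inductive Arg (V : Type) : Type where
  | var (x : V)
  | const (b : Bool)

/-- The value of an argument under an assignment. -/
def Arg.eval {V : Type} (a : V → Bool) : Arg V → Bool
  | Arg.var x => a x
  | Arg.const b => b

/-- A constraint application `R(ξ₁, …, ξₖ)` with a `k`-ary relation `R ∈ S`. -/
structure Constraint (S : Set (Σ k : ℕ, Set (Fin k → Bool))) (V : Type) where
  rel : Σ k : ℕ, Set (Fin k → Bool)
  rel_mem : rel ∈ S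
  args : Fin rel.1 → Arg V

/-- The assignment `a` satisfies the constraint. -/
def Constraint.Sat {S : Set (Σ k : ℕ, Set (Fin k → Bool))} {V : Type}
    (C : Constraint S V) (a : V → Bool) : Prop :=
  (fun j => (C.args j).eval a) ∈ C.rel.2

/-- A `CNF_C(S)`-formula over `V`: a finite conjunction of constraint applications. -/
abbrev CNFC (S : Set (Σ k : ℕ, Set (Fin k → Bool))) (V : Type) : Type :=
  List (Constraint S V)

/-- The set of solutions of a `CNF_C(S)`-formula. -/
def CNFC.solutions {S : Set (Σ k : ℕ, Set (Fin k → Bool))} {V : Type} (φ : CNFC S V) :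
    Set (V → Bool) :=
  {a | ∀ C ∈ φ, C.Sat a}

/-- `Q` is expressible as a `CNF_C(S)`-formula (over the variables of `Q`, without auxiliary
variables). -/
def IsExpressible (S : Set (Σ k : ℕ, Set (Fin k → Bool))) {n : ℕ} (Q : Set (Fin n → Bool)) :
    Prop :=
  ∃ φ : CNFC S (Fin n), CNFC.solutions φ = Q

/-- The relation `M = (x ∨ ȳ ∨ z̄) ∧ (x̄ ∨ z)`, with `x, y, z` the coordinates `0, 1, 2`. -/
def relM : Set (Fin 3 → Bool) :=
  {a | (a 0 = true ∨ a 1 = false ∨ a 2 = false) ∧ (a 0 = false ∨ a 2 = true)}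

end BoolCSP

namespace BoolCSP

/-! Horn relations and their identifications are closed under meets. Closure under `a ⊓ (b ⊔ c)`
makes a relation IHSB−, so some component of a bad identification violates it. Following a path in
that component turns the violation into a local one (`HasObstruction`): a flip allowed at `d` and `c
⊓ d` but not at some `u` between them. Grouping coordinates by their values in `c`, `d`, `u` gives a
ternary instance of `R` with enough known values to define `M`. -/

theorem IsHorn.inf_mem {n : ℕ} {R : Set (Fin n → Bool)} (h : IsHorn R) {a b : Fin n → Bool}
    (ha : a ∈ R) (hb : b ∈ R) : a ⊓ b ∈ R := by
  obtain ⟨φ, hφ, rfl⟩ := h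
  intro c hc
  obtain ⟨⟨i, p⟩, hl, hai⟩ := ha c hc
  obtain ⟨⟨j, q⟩, hl', hbj⟩ := hb c hc
  simp only at hai hbj
  cases p with
  | false => exact ⟨_, hl, by simp [hai]⟩
  | true =>
    cases q with
    | false => exact ⟨_, hl', by simp [hbj]⟩
    | true =>
      have h1 := Finset.card_le_one.1 (hφ c hc) (i, true) (by simp [hl]) (j, true) (by simp [hl'])
      obtain rfl : i = j := congrArg Prod.fst h1
      exact ⟨_, hl, by simp [hai, hbj]⟩

/-! ### Closure under `a ⊓ (b ⊔ c)` and IHSB− formulas -/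

/-- A relation preserved by `a ∧ (b ∨ c)` is IHSB−. -/
theorem isIHSBMinus_of_closed {n : ℕ} (hn : 1 ≤ n) {R : Set (Fin n → Bool)}
    (hR : ∀ a ∈ R, ∀ b ∈ R, ∀ c ∈ R, a ⊓ (b ⊔ c) ∈ R) : IsIHSBMinus R := by
  classical
  have hinf : ∀ a ∈ R, ∀ b ∈ R, a ⊓ b ∈ R := fun a ha b hb => by
    simpa using hR a ha b hb b hb
  let L : Finset (Clause (Fin n)) := Finset.univ.filter fun c =>
    (c.IsHorn ∧ c.IsIHSBMinus) ∧ ∀ a ∈ R, c.Sat a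
  have hL : ∀ c, c ∈ L ↔ (c.IsHorn ∧ c.IsIHSBMinus) ∧ ∀ a ∈ R, c.Sat a := by simp [L]
  have small : ∀ c : Clause (Fin n), c.card ≤ 2 → c.IsIHSBMinus := fun c h h' => by omega
  -- A tautology guarantees at least one clause.
  have htaut : ({(⟨0, hn⟩, true), (⟨0, hn⟩, false)} : Clause (Fin n)) ∈ L := by
    refine (hL _).2 ⟨⟨by simp [Clause.IsHorn, Finset.filter_insert, Finset.filter_singleton],
      small _ Finset.card_le_two⟩, fun a _ => ?_⟩
    cases h : a ⟨0, hn⟩ <;> simp [Clause.Sat, h]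
  refine ⟨⟨L.toList, fun h => ?_⟩, fun c hc => ((hL c).1 (Finset.mem_toList.1 hc)).1, ?_⟩
  · rw [Finset.toList_eq_nil] at h
    simp [h] at htaut
  refine Set.Subset.antisymm (fun v hv => ?_)
    (fun a ha c hc => ((hL c).1 (Finset.mem_toList.1 hc)).2 a ha)
  have key : ∀ c : Clause (Fin n), c.IsHorn → c.IsIHSBMinus → ¬ c.Sat v →
      ∃ a ∈ R, ¬ c.Sat a := by
    intro c h1 h2 h3
    by_contra! h
    exact h3 (hv c (Finset.mem_toList.2 ((hL c).2 ⟨⟨h1, h2⟩, h⟩)))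
  -- The violated clause would be the negative clause on the support of `v`, the only place where
  -- long clauses are needed.
  obtain ⟨t, ht, hvt⟩ : ∃ t ∈ R, v ≤ t := by
    obtain ⟨t, ht, h⟩ := key ((Finset.univ.filter fun i => v i = true).image fun i => (i, false))
      (by simp [Clause.IsHorn, Finset.filter_image])
      (fun _ l hl => by
        obtain ⟨i, -, rfl⟩ := Finset.mem_image.1 hl
        rfl)
      (by simp [Clause.Sat])
    refine ⟨t, ht, fun i hi => ?_⟩
    by_contra h'
    exact h ⟨(i, false), Finset.mem_image.2 ⟨i, by simpa using hi, rfl⟩, by simpa using h'⟩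
  have avoid : ∀ j : Option (Fin n), (∀ k ∈ j, v k = true) → ∀ i, v i = false →
      ∃ w ∈ R, w i = false ∧ ∀ k ∈ j, w k = true := by
    intro j hj i hi
    cases j with
    | none =>
      obtain ⟨w, hw, h⟩ := key {(i, true)} (by simp [Clause.IsHorn, Finset.filter_singleton])
        (small _ (by simp)) (by simp [Clause.Sat, hi])
      exact ⟨w, hw, by simpa [Clause.Sat] using h, by simp⟩
    | some k =>
      have hk := hj k rfl
      obtain ⟨w, hw, h⟩ := key {(i, true), (k, false)}
        (by simp [Clause.IsHorn, Finset.filter_insert, Finset.filter_singleton])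
        (small _ Finset.card_le_two) (by simp [Clause.Sat, hi, hk])
      simp [Clause.Sat] at h
      exact ⟨w, hw, h.1, by simpa using h.2⟩
  have below : ∀ j : Option (Fin n), (∀ k ∈ j, v k = true) →
      ∃ w ∈ R, w ≤ v ∧ ∀ k ∈ j, w k = true := by
    intro j hj
    have aux : ∀ T : Finset (Fin n), ∃ w ∈ R, (∀ i ∈ T, v i = false → w i = false) ∧
        ∀ k ∈ j, w k = true := by
      intro T
      induction T using Finset.induction_on with
      | empty => exact ⟨t, ht, by simp, fun k hk => hvt k (hj k hk)⟩
      | insert i T _ ih =>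
        obtain ⟨w, hw, h1, h2⟩ := ih
        cases hi : v i with
        | true =>
          refine ⟨w, hw, fun i' hi' h => ?_, h2⟩
          rcases Finset.mem_insert.1 hi' with rfl | h'
          · simp [hi] at h
          · exact h1 _ h' h
        | false =>
          obtain ⟨w', hw', h1', h2'⟩ := avoid j hj i hi
          refine ⟨w ⊓ w', hinf _ hw _ hw', fun i' hi' h => ?_, fun k hk => by
            simp [h2 k hk, h2' k hk]⟩
          rcases Finset.mem_insert.1 hi' with rfl | h'
          · simp [h1']
          · simp [h1 _ h' h]
    obtain ⟨w, hw, h1, h2⟩ := aux Finset.univ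
    refine ⟨w, hw, fun i hi => ?_, h2⟩
    by_contra h
    have := h1 i (Finset.mem_univ _) (by simpa using h)
    simp [this] at hi
  have aux : ∀ T : Finset (Fin n), ∃ w ∈ R, w ≤ v ∧ ∀ i ∈ T, v i = true → w i = true := by
    intro T
    induction T using Finset.induction_on with
    | empty =>
      obtain ⟨w, hw, h, -⟩ := below none (by simp)
      exact ⟨w, hw, h, by simp⟩
    | insert i T _ ih =>
      obtain ⟨w, hw, h1, h2⟩ := ih
      by_cases hi : v i = true
      · obtain ⟨w', hw', h1', h2'⟩ := below (some i) (by simpa using hi)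
        -- Joins below `t` stay in `R`, since there `t ⊓ (w ⊔ w') = w ⊔ w'`.
        refine ⟨w ⊔ w', ?_, sup_le h1 h1', fun i' hi' h => ?_⟩
        · simpa [inf_eq_right.2 ((sup_le h1 h1').trans hvt)] using hR t ht w hw w' hw'
        · rcases Finset.mem_insert.1 hi' with rfl | h'
          · simp [h2' _ rfl]
          · simp [h2 _ h' h]
      · refine ⟨w, hw, h1, fun i' hi' h => ?_⟩
        rcases Finset.mem_insert.1 hi' with rfl | h'
        · exact absurd h hi
        · exact h2 _ h' h
  obtain ⟨w, hw, h1, h2⟩ := aux Finset.univ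
  rwa [← le_antisymm h1 fun i hi => h2 i (Finset.mem_univ _) hi]

theorem hypercube_adj_iff {n : ℕ} {a b : Fin n → Bool} :
    (hypercube n).Adj a b ↔ ∃ l, a l ≠ b l ∧ ∀ i, i ≠ l → a i = b i := by
  change hammingDist a b = 1 ↔ _
  rw [hammingDist, Finset.card_eq_one]
  refine exists_congr fun l => ?_
  simp only [Finset.ext_iff, Finset.mem_filter, Finset.mem_univ, true_and, Finset.mem_singleton]
  constructor
  · intro h
    exact ⟨(h l).2 rfl, fun i hi => not_not.1 fun h' => hi ((h i).1 h')⟩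
  · rintro ⟨h1, h2⟩ i
    exact ⟨fun h => not_not.1 fun h' => h (h2 i h'), fun h => h ▸ h1⟩

/-! ### Obstructions and components -/

/-- A local failure of closure under `a ∧ (b ∨ c)`: flipping the coordinate `l` is possible at `d`
and at `c ∧ d`, but not at the vector `u` between them. -/
def HasObstruction {n : ℕ} (R : Set (Fin n → Bool)) : Prop :=
  ∃ (l : Fin n) (c d u : Fin n → Bool), c ∈ R ∧ d ∈ R ∧ u ∈ R ∧
    d l = false ∧ Function.update d l true ∈ R ∧ c l = true ∧ c ≤ Function.update d l true ∧
    u ≤ d ∧ c ⊓ d ≤ u ∧ Function.update u l true ∉ R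

theorem update_eq_of_step {n : ℕ} {d d' : Fin n → Bool} {l : Fin n} (hl' : d' l = true)
    (h : ∀ i, i ≠ l → d i = d' i) : Function.update d l true = d' := by
  funext i
  by_cases hi : i = l
  · subst hi; simp [hl']
  · simp [hi, h i hi]

theorem sup_inf_mem_of_adj {n : ℕ} {R : Set (Fin n → Bool)}
    (hR : ∀ a ∈ R, ∀ b ∈ R, a ⊓ b ∈ R) (hno : ¬ HasObstruction R) {b c d d' : Fin n → Bool}
    (hb : b ∈ R) (hc : c ∈ R) (hd : d ∈ R) (hd' : d' ∈ R) (hadj : (hypercube n).Adj d d')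
    (h : (b ⊔ c) ⊓ d ∈ R) : (b ⊔ c) ⊓ d' ∈ R := by
  obtain ⟨l, hl, hne⟩ := hypercube_adj_iff.1 hadj
  cases hdl : d l with
  | true =>
    have hle : d' ≤ d := by
      intro i
      by_cases hi : i = l
      · subst hi; rw [hdl]; exact Bool.le_true _
      · rw [hne i hi]
    have := hR _ h _ hd'
    rwa [inf_assoc, inf_eq_right.2 hle] at this
  | false =>
    have hdl' : d' l = true := by
      cases h' : d' l <;> simp_all
    have hup := update_eq_of_step hdl' hne
    have hle : d ≤ d' := by
      intro i
      by_cases hi : i = l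
      · subst hi; rw [hdl]; exact Bool.false_le _
      · rw [hne i hi]
    -- If the flipped vector left `R`, then `e ⊓ d'`, `d` and `(b ⊔ c) ⊓ d` would form an
    -- obstruction.
    have main : ∀ e ∈ R, e ≤ b ⊔ c → e l = true → (b ⊔ c) ⊓ d' ∈ R := by
      intro e he hebc hel
      by_contra hnot
      refine hno ⟨l, e ⊓ d', d, (b ⊔ c) ⊓ d, hR _ he _ hd', hd, h, hdl, hup ▸ hd',
        by simp [hel, hdl'], hup ▸ inf_le_right, inf_le_right, ?_, ?_⟩
      · rw [inf_assoc]
        exact inf_le_inf hebc inf_le_right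
      · have hbc : (b ⊔ c) l = true := hebc l hel
        rwa [update_eq_of_step (d' := (b ⊔ c) ⊓ d')]
        · simpa [hdl'] using hbc
        · intro i hi
          simp [hne i hi]
    cases hbl : b l with
    | true => exact main b hb le_sup_left hbl
    | false =>
      cases hcl : c l with
      | true => exact main c hc le_sup_right hcl
      | false =>
        have : (b ⊔ c) ⊓ d' = (b ⊔ c) ⊓ d := by
          funext i
          by_cases hi : i = l
          · subst hi; simp [hbl, hcl]
          · simp [hne i hi]
        rwa [this]

/-- As `d` walks from `b` to `a`, the vector `(b ⊔ c) ⊓ d` starts at `b` and at each step stays put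
or moves to a neighbour in `R`, so it never leaves the component. -/
theorem isComponentwiseIHSBMinus_of_not_hasObstruction {n : ℕ} (hn : 1 ≤ n)
    {R : Set (Fin n → Bool)} (hR : ∀ a ∈ R, ∀ b ∈ R, a ⊓ b ∈ R) (hno : ¬ HasObstruction R) :
    IsComponentwiseIHSBMinus R := by
  intro C
  refine isIHSBMinus_of_closed hn ?_
  rintro _ ⟨a, ha, rfl⟩ _ ⟨b, hb, rfl⟩ _ ⟨c, hc, rfl⟩
  have step : ∀ d d' : R, (solutionGraph R).Adj d d' →
      (∃ e ∈ C.supp, e.1 = (b.1 ⊔ c.1) ⊓ d.1) → ∃ e ∈ C.supp, e.1 = (b.1 ⊔ c.1) ⊓ d'.1 := by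
    rintro d d' hadj ⟨e, he, hed⟩
    have hadj' : (hypercube n).Adj d.1 d'.1 := hadj
    have hmem := sup_inf_mem_of_adj hR hno b.2 c.2 d.2 d'.2 hadj' (hed ▸ e.2)
    refine ⟨⟨_, hmem⟩, ?_, rfl⟩
    by_cases heq : e.1 = (b.1 ⊔ c.1) ⊓ d'.1
    · exact (show e = ⟨_, hmem⟩ from Subtype.ext heq) ▸ he
    · refine C.mem_supp_of_adj_mem_supp he (show (hypercube n).Adj e.1 _ from ?_)
      obtain ⟨l, -, hne⟩ := hypercube_adj_iff.1 hadj'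
      have hne' : ∀ i, i ≠ l → e.1 i = ((b.1 ⊔ c.1) ⊓ d'.1) i := fun i hi => by
        simp [hed, hne i hi]
      refine hypercube_adj_iff.2 ⟨l, fun hl => heq (funext fun i => ?_), hne'⟩
      by_cases hi : i = l
      · rw [hi]; exact hl
      · exact hne' i hi
  have walk : ∀ d d' : R, (solutionGraph R).Walk d d' →
      (∃ e ∈ C.supp, e.1 = (b.1 ⊔ c.1) ⊓ d.1) → ∃ e ∈ C.supp, e.1 = (b.1 ⊔ c.1) ⊓ d'.1 := by
    intro d d' w
    induction w with
    | nil => exact id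
    | cons hadj _ ih => exact fun h => ih (step _ _ hadj h)
  obtain ⟨w⟩ := SimpleGraph.ConnectedComponent.exact (hb.trans ha.symm)
  obtain ⟨e, he, hea⟩ := walk b a w ⟨b, hb, (inf_eq_right.2 le_sup_left).symm⟩
  exact ⟨e, he, hea.trans (inf_comm _ _)⟩

/-! ### Defining `M` from an obstruction -/

/-- From an obstruction in an identification of `R`, the relation `M` arises as
`F(x, z, y) ∧ F(z, 1, x)` for a substitution instance `F` of `R`. -/
theorem isExpressible_relM_of_hasObstruction {n m : ℕ} {R : Set (Fin n → Bool)}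
    {f : Fin n → Fin m} (hR : ∀ a ∈ identify R f, ∀ b ∈ identify R f, a ⊓ b ∈ identify R f)
    (h : HasObstruction (identify R f)) : IsExpressible {⟨n, R⟩} relM := by
  obtain ⟨l, c, d, u, hc, hd, hu, hdl, hd', hcl, hcd, hud, hcu, hnot⟩ := h
  let F (X Y Z : Arg (Fin 3)) : Constraint {⟨n, R⟩} (Fin 3) :=
    ⟨⟨n, R⟩, rfl, fun j => if f j = l then Z else if d (f j) = false then Arg.const false else
      if u (f j) = false then X else if c (f j) = false then Y else Arg.const true⟩
  let G (x y z : Bool) : Fin m → Bool := fun k => if k = l then z else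
    d k && (if u k = false then x else c k || y)
  have hF : ∀ X Y Z a, (F X Y Z).Sat a ↔ G (X.eval a) (Y.eval a) (Z.eval a) ∈ identify R f := by
    intro X Y Z a
    change _ ∈ R ↔ _ ∈ R
    refine iff_of_eq (congrArg (· ∈ R) (funext fun j => ?_))
    simp only [F, G]
    split_ifs <;> simp_all [Arg.eval]
  have hul : u l = false := by
    by_contra h
    have := hud l (by simpa using h)
    simp [hdl] at this
  have hud' : ∀ k, u k = true → d k = true := fun k => hud k
  have hcd' : ∀ k, k ≠ l → c k = true → d k = true := fun k hk h => by
    simpa [hk] using hcd k h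
  have hcu' : ∀ k, c k = true → d k = true → u k = true := fun k h1 h2 =>
    hcu k (by simp [h1, h2])
  -- The values 000, 010, 001, 110, 111 come from `c ⊓ d`, `u`, `c`, `d` and the flipped `d`; 011 is
  -- the missing flip of `u`.
  have g000 : G false false false ∈ identify R f := by
    convert hR _ hc _ hd using 1
    funext k
    have := hcu' k
    by_cases hk : k = l
    · subst hk; simp [G, hdl]
    · cases h1 : u k <;> cases h2 : d k <;> cases h3 : c k <;> simp_all [G]
  have g010 : G false true false ∈ identify R f := by
    convert hu using 1
    funext k
    have := hud' k
    by_cases hk : k = l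
    · subst hk; simp [G, hul]
    · cases h1 : u k <;> cases h2 : d k <;> simp_all [G]
  have g001 : G false false true ∈ identify R f := by
    convert hc using 1
    funext k
    have := hcu' k
    have := hcd' k
    by_cases hk : k = l
    · subst hk; simp [G, hcl]
    · cases h1 : u k <;> cases h2 : d k <;> cases h3 : c k <;> simp_all [G]
  have g110 : G true true false ∈ identify R f := by
    convert hd using 1
    funext k
    by_cases hk : k = l
    · subst hk; simp [G, hdl]
    · simp [G, hk]
  have g111 : G true true true ∈ identify R f := by
    convert hd' using 1
    funext k
    by_cases hk : k = l
    · subst hk; simp [G]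
    · simp [G, hk]
  have g011 : G false true true ∉ identify R f := by
    convert hnot using 2
    funext k
    have := hud' k
    by_cases hk : k = l
    · subst hk; simp [G]
    · cases h1 : u k <;> cases h2 : d k <;> simp_all [G]
  -- The unknown values 100 and 101 do not matter: they arise only in the first constraint when x =
  -- 1, z = 0, and there the second constraint fails as 011.
  refine ⟨[F (.var 0) (.var 2) (.var 1), F (.var 2) (.const true) (.var 0)], ?_⟩
  ext a
  have : a ∈ CNFC.solutions [F (.var 0) (.var 2) (.var 1), F (.var 2) (.const true) (.var 0)] ↔
      G (a 0) (a 2) (a 1) ∈ identify R f ∧ G (a 2) true (a 0) ∈ identify R f := by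
    simp only [CNFC.solutions, Set.mem_ofPred_eq, List.forall_mem_cons, hF, Arg.eval]
    simp
  rw [this]
  cases h0 : a 0 <;> cases h1 : a 1 <;> cases h2 : a 2 <;>
    simp [relM, h0, h1, h2, g000, g010, g001, g110, g111, g011]

end BoolCSP

theorem mainTheorem10 (n : ℕ) (hn : 1 ≤ n) (R : Set (Fin n → Bool))
    (hHorn : BoolCSP.IsHorn R) (hR : ¬ BoolCSP.IsSafelyComponentwiseIHSBMinus R) :
    BoolCSP.IsExpressible {⟨n, R⟩} BoolCSP.relM := by
  simp only [BoolCSP.IsSafelyComponentwiseIHSBMinus, not_forall] at hR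
  obtain ⟨m, f, hf, hC⟩ := hR
  have hinf : ∀ a ∈ BoolCSP.identify R f, ∀ b ∈ BoolCSP.identify R f,
      a ⊓ b ∈ BoolCSP.identify R f := fun a ha b hb => hHorn.inf_mem ha hb
  refine BoolCSP.isExpressible_relM_of_hasObstruction hinf (not_not.1 fun hno => hC ?_)
  exact BoolCSP.isComponentwiseIHSBMinus_of_not_hasObstruction
    (Nat.lt_of_le_of_lt (Nat.zero_le _) (f ⟨0, hn⟩).2) hinf hno
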